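/- **Notation.** Write $\mathbb N=\{1,2,\dots\}$. Let $\boldsymbol\ell:\mathbb N\to\mathbb N\cup\{\infty\}$ be non-decreasing and $\boldsymbol\ell^*:=\sup_n\boldsymbol\ell(n)$. For $d,n\in\mathbb N$ let $\Sigma^{\boldsymbol\ell}_{d,n}$ be the set of functions $\mathbb R^d\to\mathbb R$ realized by fully connected ReLU networks with at most $n$ nonzero weights and biases, at most $\boldsymbol\ell(n)$ layers (affine maps), and all weights and biases in $[-1,1]$. For $\alpha>0$ and $f:\mathbb R^d\to\mathbb R$ put $$\Gamma^{\alpha,\infty}(f):=\max\Big\{\|f\|_{L^\infty(\mathbb R^d)},\ \sup_{n\in\mathbb N} n^\alpha\inf_{g\in\Sigma^{\boldsymbol\ell}_{d,n}}\|f-g\|_{L^\infty(\mathbb R^d)}\Big\},\qquad \|f\|_{A^{\alpha,\infty}_{\boldsymbol\ell}}:=\inf\{\theta>0:\Gamma^{\alpha,\infty}(f/\theta)\le1\},$$ and let $U^{\alpha,\infty}_{\boldsymbol\ell}(\mathbb R^d)$ be the set of $f$ with $\|f\|_{A^{\alpha,\infty}_{\boldsymbol\ell}}\le 1$; such $f$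 are identified with their continuous representatives. Let $\mathsf U\subset C(\mathcal X)$ be a set of continuous real-valued functions on $\mathcal X$ that is embedded in a Banach space $\mathsf V$. A deterministic method using $N$ point measurements is a map $A:\mathsf U\to\mathsf V$ of the form $A(G)=Q(G(u_1),\dots,G(u_N))$ with $u_1,\dots,u_N\in\mathcal X$ and an arbitrary map $Q:\mathbb R^N\to\mathsf V$. A (strongly measurable) randomized method using $N$ point measurements in expectation consists of a probability space $(\Omega,\mathcal F,\mathbb P)$, a measurable $\mathsf N:\Omega\to\mathbb N\cup\{0\}$ with $\mathbb E[\mathsf N]\le N$, and maps $A_\omega:\mathsf U\to\mathsf V$ such that each $A_\omega$ is a deterministic method using $\mathsf N(\omega)$ point measurements and $(\omega,G)\mapsto A_\omega(G)$ is measurable, where $\mathsf U$ carries the Borel $\sigma$-algebra of uniform convergence on $\mathcal X$ and $\mathsf V$ its Borel $\sigma$-algebra. Let $e_N^{\mathrm{ran}}(\mathsf U,\mathsf V)$ be the infimum of $\sup_{G\in\mathsf U}\mathbb E_\omega\|G-A_\omega(G)\|_{\mathsf V}$ over all such randomized methods, and $$\beta_*(\mathsf U,\mathsf V):=\sup\big\{\beta\ge0:\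 \exists\,C>0\ \ \forall N\in\mathbb N:\ e_N^{\mathrm{ran}}(\mathsf U,\mathsf V)\le C N^{-\beta}\big\}.$$ **Proposition.** Let $\mathcal X$ be a separable Banach space, $\mu$ a Borel probability measure on $\mathcal X$, $1\le p<\infty$, and $\mathsf U\subset C(\mathcal X)$ a set of continuous functions $\mathcal X\to\mathbb R$ with $\mathsf U\subset L^p(\mu)$. Let $d\in\mathbb N$, let $\mathcal E:\mathcal X\to\mathbb R^d$ be measurable, and let $c>0$ be such that $$\mathcal E_\#\mu\ \ge\ c\cdot\mathrm{Unif}([0,1]^d).$$ Let $\alpha>0$ and let $\boldsymbol\ell:\mathbb N\to\mathbb N\cup\{\infty\}$ be non-decreasing with $\boldsymbol\ell^*\ge3$. If $f\circ\mathcal E\in\mathsf U$ for every $f\in U^{\alpha,\infty}_{\boldsymbol\ell}(\mathbb R^d)$, then $$\beta_*(\mathsf U,L^p(\mu))\ \le\ \frac1p+\frac1d\cdot\frac{\alpha}{\alpha+\lfloor\boldsymbol\ell^*/2\rfloor},$$ where the last fraction is $0$ if $\boldsymbol\ell^*=\infty$. -/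

import Mathlib

open MeasureTheory
open scoped ENNReal NNReal

universe u v w

/-! ### ReLU neural networks -/

/-- A (fully connected) neural network `((A₁, b₁), …, (A_L, b_L))` with `L ≥ 1` layers, input
dimension `m` and output dimension `n`: either one layer `(A, b)`, or a first layer `(A, b)`
followed by a network. -/
inductive ReLUNet : ℕ → ℕ → Type
  | last {m n : ℕ} (A : Matrix (Fin n) (Fin m) ℝ) (b : Fin n → ℝ) : ReLUNet m n
  | cons {m k n : ℕ} (A : Matrix (Fin k) (Fin m) ℝ) (b : Fin k → ℝ) (ψ : ReLUNet k n) :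
      ReLUNet m n

namespace ReLUNet

/-- The number of layers. -/
def depth : {m n : ℕ} → ReLUNet m n → ℕ
  | _, _, last _ _ => 1
  | _, _, cons _ _ ψ => ψ.depth + 1

/-- The number of nonzero entries of the matrix and of the bias vector of one layer. -/
noncomputable def layerWeights {m n : ℕ} (A : Matrix (Fin n) (Fin m) ℝ) (b : Fin n → ℝ) : ℕ :=
  Set.ncard {ij : Fin n × Fin m | A ij.1 ij.2 ≠ 0} + Set.ncard {i : Fin n | b i ≠ 0}

/-- The number of nonzero weights `W(ψ)`. -/
noncomputable def numWeights : {m n : ℕ} → ReLUNet m n → ℕ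
  | _, _, last A b => layerWeights A b
  | _, _, cons A b ψ => layerWeights A b + ψ.numWeights

/-- The largest absolute value of an entry of the matrix or of the bias vector of one layer. -/
noncomputable def layerMax {m n : ℕ} (A : Matrix (Fin n) (Fin m) ℝ) (b : Fin n → ℝ) : ℝ≥0 :=
  max (Finset.univ.sup fun ij : Fin n × Fin m => ‖A ij.1 ij.2‖₊) (Finset.univ.sup fun i => ‖b i‖₊)

/-- The weight magnitude `‖ψ‖_NN`. -/
noncomputable def maxWeight : {m n : ℕ} → ReLUNet m n → ℝ≥0
  | _, _, last A b => layerMax A b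
  | _, _, cons A b ψ => max (layerMax A b) ψ.maxWeight

/-- The ReLU realization `T_L ∘ (σ ∘ T_{L-1}) ∘ ⋯ ∘ (σ ∘ T_1)`, where `T_j x = A_j x + b_j` and
`σ t = max 0 t` acts componentwise. -/
noncomputable def realize : {m n : ℕ} → ReLUNet m n → (Fin m → ℝ) → (Fin n → ℝ)
  | _, _, last A b => fun x => A.mulVec x + b
  | _, _, cons A b ψ => fun x => ψ.realize fun i => max 0 ((A.mulVec x + b) i)

end ReLUNet

/-! ### Neural network approximation spaces on `ℝ^d` -/

/-- The class `Σ_{d,n}^ℓ` of realizations of networks `ℝ^d → ℝ` with at most `n` nonzero weights,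
depth at most `ℓ n`, and weights of absolute value at most `1`. -/
def networkClass (d : ℕ) (ℓ : ℕ+ → ℕ∞) (n : ℕ+) : Set ((Fin d → ℝ) → ℝ) :=
  {g | ∃ ψ : ReLUNet d 1, ψ.numWeights ≤ n ∧ (ψ.depth : ℕ∞) ≤ ℓ n ∧ ψ.maxWeight ≤ 1 ∧
    ∀ x, g x = ψ.realize x 0}

/-- The distance of `f` to a set `S` of functions in the norm of `L^∞(ℝ^d)`. -/
noncomputable def distSup {d : ℕ} (f : (Fin d → ℝ) → ℝ) (S : Set ((Fin d → ℝ) → ℝ)) : ℝ≥0∞ :=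
  ⨅ g ∈ S, eLpNorm (fun x => f x - g x) ∞ volume

/-- `Γ^{α,∞}(f) = max {‖f‖_{L^∞}, sup_{n ≥ 1} n^α · dist(f, Σ_{d,n}^ℓ)}`. -/
noncomputable def approxGamma {d : ℕ} (α : ℝ) (ℓ : ℕ+ → ℕ∞) (f : (Fin d → ℝ) → ℝ) : ℝ≥0∞ :=
  max (eLpNorm f ∞ volume)
    (⨆ n : ℕ+, ((n : ℕ) : ℝ≥0∞) ^ α * distSup f (networkClass d ℓ n))

/-- The quasi-norm `inf {θ > 0 : Γ^{α,∞}(f / θ) ≤ 1}` of the approximation space. -/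
noncomputable def approxQuasiNorm {d : ℕ} (α : ℝ) (ℓ : ℕ+ → ℕ∞) (f : (Fin d → ℝ) → ℝ) : ℝ≥0∞ :=
  ⨅ (θ : ℝ) (_ : 0 < θ) (_ : approxGamma α ℓ (fun x => f x / θ) ≤ 1), ENNReal.ofReal θ

/-- The unit ball `U^{α,∞}_ℓ(ℝ^d)`. A class in `L^∞(ℝ^d)` of finite quasi-norm is an `L^∞`-limit of
continuous functions, so it has a unique continuous representative; the unit ball is taken to
consist of these representatives, so that its elements have point values. -/
def approxUnitBall (d : ℕ) (α : ℝ) (ℓ : ℕ+ → ℕ∞) : Set C(Fin d → ℝ, ℝ) :=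
  {f | approxQuasiNorm α ℓ f ≤ 1}

/-- `ℓ^* = sup_n ℓ(n)`. -/
noncomputable def maxDepth (ℓ : ℕ+ → ℕ∞) : ℕ∞ := ⨆ n, ℓ n

/-- `⌊ℓ^*/2⌋`, which is `∞` if `ℓ^* = ∞`. -/
noncomputable def halfMaxDepth (ℓ : ℕ+ → ℕ∞) : ℕ∞ := (maxDepth ℓ).map (fun k => k / 2)

/-! ### Sampling complexity -/

section Sampling

variable {X : Type u} [TopologicalSpace X] {V : Type v} [NormedAddCommGroup V]

/-- `A : U → V` is a deterministic method using `N` point measurements. -/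
def IsDetMethod (U : Set C(X, ℝ)) (N : ℕ) (A : U → V) : Prop :=
  ∃ (x : Fin N → X) (Q : (Fin N → ℝ) → V), ∀ f : U, A f = Q fun i => (f : C(X, ℝ)) (x i)

/-- The Borel `σ`-algebra on a set `U` of continuous functions for uniform convergence on all of
`X`, i.e. for the (extended) metric `sup_x |f x - g x|`. -/
abbrev uniformBorel (U : Set C(X, ℝ)) : MeasurableSpace U :=
  @borel U (TopologicalSpace.induced
    (fun f : U => UniformFun.ofFun (fun x => (f : C(X, ℝ)) x)) inferInstance)

/-- A strongly measurable randomized method on `U` with values in `V` that uses `N` point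
measurements in expectation. The normed space `V` carries its Borel `σ`-algebra. -/
structure RandMethod (U : Set C(X, ℝ)) (V : Type v) [NormedAddCommGroup V] (N : ℕ) where
  /-- the probability space -/
  Ω : Type w
  mΩ : MeasurableSpace Ω
  P : Measure Ω
  isProb : IsProbabilityMeasure P
  /-- the family of maps `A_ω : U → V` -/
  A : Ω → U → V
  /-- the number of point measurements of `A_ω` -/
  cost : Ω → ℕ
  measurable_cost : Measurable cost
  /-- joint measurability of `(ω, f) ↦ A_ω(f)`; it contains the measurability of
  `ω ↦ A_ω(f)` for every fixed `f` -/
  measurable_joint : @Measurable (Ω × U) V (mΩ.prod (uniformBorel U)) (borel V)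
    fun q => A q.1 q.2
  isDet : ∀ ω, IsDetMethod U (cost ω) (A ω)
  lintegral_cost_le : ∫⁻ ω, (cost ω : ℝ≥0∞) ∂P ≤ N

/-- The expected error `sup_{f ∈ U} E_ω ‖f - A_ω(f)‖_V` of a randomized method, where `ι : U → V` is
the canonical embedding. -/
noncomputable def RandMethod.error {U : Set C(X, ℝ)} {N : ℕ} (ι : U → V)
    (M : RandMethod.{u, v, w} U V N) : ℝ≥0∞ :=
  letI := M.mΩ
  ⨆ f : U, ∫⁻ ω, ‖ι f - M.A ω f‖ₑ ∂M.P

/-- The optimal randomized error using `N` point measurements in expectation. -/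
noncomputable def optRandError (U : Set C(X, ℝ)) (ι : U → V) (N : ℕ) : ℝ≥0∞ :=
  ⨅ M : RandMethod.{u, v, w} U V N, M.error ι

/-- The optimal randomized order of convergence `β_*(U, V) ∈ [0, ∞]`: the supremum of all `β ≥ 0`
such that, for some `C > 0`, the optimal randomized error is at most `C N^{-β}` for all `N ≥ 1`. -/
noncomputable def betaStar (U : Set C(X, ℝ)) (ι : U → V) : ℝ≥0∞ :=
  ⨆ (β : ℝ≥0) (_ : ∃ C : ℝ, 0 < C ∧ ∀ N : ℕ, 1 ≤ N →
    optRandError.{u, v, w} U ι N ≤ ENNReal.ofReal (C * (N : ℝ) ^ (-(β : ℝ)))), (β : ℝ≥0∞)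

/-- The canonical embedding into `L^p(μ)` of a set `U` of `p`-integrable continuous functions. -/
noncomputable def lpEmbedding [MeasurableSpace X] {μ : Measure X} {p : ℝ≥0∞} (U : Set C(X, ℝ))
    (hU : ∀ G ∈ U, MemLp G p μ) : U → Lp ℝ p μ :=
  fun G => (hU G.1 G.2).toLp G.1

end Sampling

/-!
A rate of convergence is refuted by fooling functions `± f ∘ E`, where `f` runs through pyramids
`pyramid y s h x = max 0 (h - s * ∑ i, |x i - y i|)` over the cells of a grid in `[0, 1]^d`.

*Steep pyramids are cheap.* With weights in `[-1, 1]`, a layer making `n` copies of a number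
followed by a layer adding them up multiplies by `n` at the price of `O(n)` weights. Hence networks with
`O(n)` weights and depth `max 3 (2 * k)` realize pyramids of slope `n ^ k`
(`ReLUNet.realize_pyramidNet`). For `k ≥ 2` the last summation is the output layer, which makes
depth `2 * k` suffice; for `k = 1` the positive part still has to be taken, which costs a third layer.
A pyramid of height at most `(K n) ^ (-α)`, where `K n` bounds the number of weights, is in the unit
ball: it is approximated by `0` by networks with fewer weights and by itself otherwise
(`mem_approxUnitBall_of_mem_networkClass`).

*Averaging.* Put `(2 m) ^ d` such pyramids on a grid of mesh `1 / (2 m)`, with slope `n ^ k` and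
height `n ^ k / (4 m)`, so that the supports are disjoint. The height condition
is `m ≳ n ^ (α + k)`.
A method with `N` samples misses all but `N` of the supports, and on a missed support it cannot
tell `f ∘ E` from `- f ∘ E`. For `N = m ^ d ≤ (2 m) ^ d / 2` the average error is at least half the
`L^p`-norm of the pyramids; this survives randomization and a number of samples that is bounded in
expectation only (`half_le_optRandError`). The lower bound on the push-forward of `μ` makes this
norm at least of order `n ^ k / m * m ^ (-d / p)` (`le_eLpNorm_pyramid_comp`).

*Exponents.* With `m ≈ n ^ (α + k)` the error is at least of order `m ^ (-α / (α + k) - d / p)`,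
compared with `N ^ (-β) = m ^ (-d * β)` (`rate_le_of_eventually`). Take `k = ⌊ℓ^* / 2⌋`, or let
`k → ∞` if `ℓ^* = ∞`.
-/

/-! ### Negation and amplification of networks -/

namespace ReLUNet

theorem layerWeights_le {m n : ℕ} (A : Matrix (Fin n) (Fin m) ℝ) (b : Fin n → ℝ) :
    layerWeights A b ≤ n * m + n := by
  unfold layerWeights
  gcongr
  · simpa using Set.ncard_le_card {ij : Fin n × Fin m | A ij.1 ij.2 ≠ 0}
  · simpa using Set.ncard_le_card {i : Fin n | b i ≠ 0}

theorem layerMax_le_one_iff {m n : ℕ} {A : Matrix (Fin n) (Fin m) ℝ} {b : Fin n → ℝ} :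
    layerMax A b ≤ 1 ↔ (∀ i j, |A i j| ≤ 1) ∧ ∀ i, |b i| ≤ 1 := by
  simp [layerMax, Finset.sup_le_iff, ← NNReal.coe_le_coe]

/-- The network computing `-ψ`, obtained by negating the last layer. -/
noncomputable def neg : {m n : ℕ} → ReLUNet m n → ReLUNet m n
  | _, _, last A b => last (-A) (-b)
  | _, _, cons A b ψ => cons A b ψ.neg

theorem depth_neg {m n : ℕ} (ψ : ReLUNet m n) : ψ.neg.depth = ψ.depth := by
  induction ψ with
  | last A b => rfl
  | cons A b ψ ih => simp [neg, depth, ih]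

theorem numWeights_neg {m n : ℕ} (ψ : ReLUNet m n) : ψ.neg.numWeights = ψ.numWeights := by
  induction ψ with
  | last A b => simp [neg, numWeights, layerWeights]
  | cons A b ψ ih => simp [neg, numWeights, ih]

theorem maxWeight_neg {m n : ℕ} (ψ : ReLUNet m n) : ψ.neg.maxWeight = ψ.maxWeight := by
  induction ψ with
  | last A b => simp [neg, maxWeight, layerMax]
  | cons A b ψ ih => simp [neg, maxWeight, ih]

theorem realize_neg {m n : ℕ} (ψ : ReLUNet m n) (x : Fin m → ℝ) :
    ψ.neg.realize x = -ψ.realize x := by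
  induction ψ with
  | last A b => simp [neg, realize, Matrix.neg_mulVec, add_comm]
  | cons A b ψ ih => simp [neg, realize, ih]

/-- A network with weights in `[-1, 1]` that multiplies a nonnegative number by `n ^ j`: each factor
`n` is gained by a layer making `n` copies followed by a layer adding them up. No layer is spent on
reading off the result when `j ≥ 1`, so that the depth is `2 * j`. -/
noncomputable def amplify (n : ℕ) : ℕ → ReLUNet 1 1
  | 0 => last (.of fun _ _ => 1) 0
  | 1 => cons (.of fun (_ : Fin n) _ => 1) 0 (last (.of fun _ _ => 1) 0)
  | j + 2 => cons (.of fun (_ : Fin n) _ => 1) 0 (cons (.of fun _ _ => 1) 0 (amplify n (j + 1)))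

theorem depth_amplify (n j : ℕ) : (amplify n j).depth = max 1 (2 * j) := by
  induction j using amplify.induct with
  | case1 => rfl
  | case2 => rfl
  | case3 j ih => simp only [amplify, depth, ih]; omega

theorem numWeights_amplify_le (n j : ℕ) (hn : 1 ≤ n) :
    (amplify n j).numWeights ≤ 4 * n * j + 2 := by
  induction j using amplify.induct with
  | case1 => simpa [amplify, numWeights] using layerWeights_le _ _
  | case2 =>
    have h₁ := layerWeights_le (.of fun (_ : Fin n) (_ : Fin 1) => (1 : ℝ)) 0
    have h₂ := layerWeights_le (.of fun (_ : Fin 1) (_ : Fin n) => (1 : ℝ)) 0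
    simp only [amplify, numWeights]
    omega
  | case3 j ih =>
    have h₁ := layerWeights_le (.of fun (_ : Fin n) (_ : Fin 1) => (1 : ℝ)) 0
    have h₂ := layerWeights_le (.of fun (_ : Fin 1) (_ : Fin n) => (1 : ℝ)) 0
    simp only [amplify, numWeights]
    nlinarith

theorem maxWeight_amplify_le (n j : ℕ) : (amplify n j).maxWeight ≤ 1 := by
  have key (a b : ℕ) : layerMax (.of fun (_ : Fin a) (_ : Fin b) => (1 : ℝ)) 0 ≤ 1 := by
    simp [layerMax_le_one_iff]
  induction j using amplify.induct with
  | case1 => exact key _ _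
  | case2 => exact max_le (key _ _) (key _ _)
  | case3 j ih => exact max_le (key _ _) (max_le (key _ _) ih)

theorem realize_amplify (n j : ℕ) (x : Fin 1 → ℝ) (hx : 0 ≤ x 0) :
    (amplify n j).realize x 0 = n ^ j * x 0 := by
  induction j using amplify.induct generalizing x with
  | case1 => simp [amplify, realize, Matrix.mulVec, dotProduct]
  | case2 => simp [amplify, realize, Matrix.mulVec, dotProduct, hx]
  | case3 j ih =>
    simp only [amplify, realize]
    rw [ih]
    · simp [Matrix.mulVec, dotProduct, hx, mul_nonneg]
      ring
    · exact le_max_left _ _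

end ReLUNet

/-! ### Pyramids as network functions -/

/-- The pyramid of height `h` and slope `s` over the `ℓ¹`-ball of radius `h / s` around `y`. -/
noncomputable def pyramid {d : ℕ} (y : Fin d → ℝ) (s h : ℝ) (x : Fin d → ℝ) : ℝ :=
  max 0 (h - s * ∑ i, |x i - y i|)

theorem pyramid_nonneg {d : ℕ} (y : Fin d → ℝ) (s h : ℝ) (x : Fin d → ℝ) :
    0 ≤ pyramid y s h x := le_max_left _ _

theorem pyramid_le {d : ℕ} (y : Fin d → ℝ) {s h : ℝ} (hs : 0 ≤ s) (hh : 0 ≤ h) (x : Fin d → ℝ) :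
    pyramid y s h x ≤ h :=
  max_le hh (sub_le_self _ (mul_nonneg hs (Finset.sum_nonneg fun _ _ => abs_nonneg _)))

@[fun_prop]
theorem continuous_pyramid {d : ℕ} (y : Fin d → ℝ) (s h : ℝ) : Continuous (pyramid y s h) := by
  unfold pyramid
  fun_prop

namespace ReLUNet

/-- A network computing the pyramid of slope `n ^ (j + 1)` and height `n ^ j * b` around `y`. The
first layer has `n` copies of the positive and of the negative part of each `x i - y i`, the second
one forms `b - n * ∑ i, |x i - y i|`, and its positive part is amplified. -/
noncomputable def pyramidNet {d : ℕ} (n j : ℕ) (y : Fin d → ℝ) (b : ℝ) : ReLUNet d 1 :=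
  let e := Fintype.equivFin (Fin d × Fin n × Bool)
  let sgn : Bool → ℝ := fun t => if t then 1 else -1
  cons (.of fun i k => if (e.symm i).1 = k then sgn (e.symm i).2.2 else 0)
    (fun i => -sgn (e.symm i).2.2 * y (e.symm i).1)
    (cons (.of fun _ _ => -1) (fun _ => b) (amplify n j))

theorem depth_pyramidNet {d : ℕ} (n j : ℕ) (y : Fin d → ℝ) (b : ℝ) :
    (pyramidNet n j y b).depth = max 3 (2 * (j + 1)) := by
  simp only [pyramidNet, depth, depth_amplify]
  omega

/-- The bound counts all entries of the layers, zero or not. For fixed `d` and `j` it is linear in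
`n`, which is all that matters. -/
theorem numWeights_pyramidNet_le {d : ℕ} (n j : ℕ) (hn : 1 ≤ n) (y : Fin d → ℝ) (b : ℝ) :
    (pyramidNet n j y b).numWeights ≤ (2 * d * (d + 2) + 4 * j + 3) * n := by
  simp only [pyramidNet, numWeights]
  refine (add_le_add (layerWeights_le _ _)
    (add_le_add (layerWeights_le _ _) (numWeights_amplify_le n j hn))).trans ?_
  simp only [Fintype.card_prod, Fintype.card_fin, Fintype.card_bool]
  nlinarith

theorem maxWeight_pyramidNet_le {d : ℕ} (n j : ℕ) {y : Fin d → ℝ} (hy : ∀ i, |y i| ≤ 1) {b : ℝ}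
    (hb : |b| ≤ 1) : (pyramidNet n j y b).maxWeight ≤ 1 := by
  refine max_le (layerMax_le_one_iff.2 ⟨fun i k => ?_, fun i => ?_⟩)
    (max_le (layerMax_le_one_iff.2 ⟨fun i k => ?_, fun i => hb⟩) (maxWeight_amplify_le n j))
  · dsimp only [Matrix.of_apply]
    split_ifs <;> simp
  · dsimp only
    rw [abs_mul]
    split_ifs <;> simp [hy]
  · simp

theorem realize_pyramidNet {d : ℕ} (n j : ℕ) (y : Fin d → ℝ) (b : ℝ) (x : Fin d → ℝ) :
    (pyramidNet n j y b).realize x 0 = pyramid y ((n : ℝ) ^ (j + 1)) ((n : ℝ) ^ j * b) x := by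
  have habs (t : ℝ) : max 0 t + max 0 (-t) = |t| := by
    rcases le_total 0 t with h | h
    · simp [h, abs_of_nonneg h]
    · simp [h, abs_of_nonpos h]
  -- The second layer: each `x i - y i` contributes `n` times its positive and its negative part.
  have hsum : (∑ i : Fin (Fintype.card (Fin d × Fin n × Bool)),
      max 0 ((∑ k, (if ((Fintype.equivFin _).symm i).1 = k then
          if ((Fintype.equivFin (Fin d × Fin n × Bool)).symm i).2.2 then (1 : ℝ) else -1 else 0)
            * x k) + -(if ((Fintype.equivFin (Fin d × Fin n × Bool)).symm i).2.2 then (1 : ℝ) else -1)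
          * y ((Fintype.equivFin _).symm i).1)) = n * ∑ i, |x i - y i| := by
    rw [Equiv.sum_comp (Fintype.equivFin (Fin d × Fin n × Bool)).symm (fun q => max 0
      ((∑ k, (if q.1 = k then if q.2.2 then (1 : ℝ) else -1 else 0) * x k)
        + -(if q.2.2 then (1 : ℝ) else -1) * y q.1))]
    simp only [Fintype.sum_prod_type, Fintype.sum_bool, ite_mul, zero_mul, Finset.sum_ite_eq,
      Finset.mem_univ, if_true, Finset.sum_const, Finset.card_univ, Fintype.card_fin,
      Bool.false_eq_true, if_false, nsmul_eq_mul, Finset.mul_sum]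
    refine Finset.sum_congr rfl fun i _ => ?_
    rw [← habs (x i - y i)]
    ring_nf
  simp only [pyramidNet, realize]
  rw [realize_amplify _ _ _ (le_max_left _ _), pyramid, mul_max_of_nonneg _ _ (by positivity),
    mul_zero]
  congr 1
  simp only [Matrix.mulVec, dotProduct, Pi.add_apply, Matrix.of_apply, neg_one_mul,
    Finset.sum_neg_distrib]
  rw [hsum]
  ring

end ReLUNet

/-! ### Network functions in the unit ball -/

theorem neg_mem_networkClass {d : ℕ} {ℓ : ℕ+ → ℕ∞} {n : ℕ+} {g : (Fin d → ℝ) → ℝ}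
    (hg : g ∈ networkClass d ℓ n) : -g ∈ networkClass d ℓ n := by
  obtain ⟨ψ, h₁, h₂, h₃, h₄⟩ := hg
  exact ⟨ψ.neg, ψ.numWeights_neg.trans_le h₁, by rwa [ψ.depth_neg], ψ.maxWeight_neg.trans_le h₃,
    fun x => by simp [ψ.realize_neg, h₄]⟩

theorem zero_mem_networkClass {d : ℕ} {ℓ : ℕ+ → ℕ∞} {n : ℕ+} (hℓ : 1 ≤ ℓ n) :
    0 ∈ networkClass d ℓ n :=
  ⟨.last 0 0, by simp [ReLUNet.numWeights, ReLUNet.layerWeights], by simpa [ReLUNet.depth],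
    by simp [ReLUNet.maxWeight, ReLUNet.layerMax], fun x => by simp [ReLUNet.realize]⟩

theorem networkClass_mono {d : ℕ} {ℓ : ℕ+ → ℕ∞} (hℓ : Monotone ℓ) :
    Monotone (networkClass d ℓ) := by
  rintro n n' hn g ⟨ψ, h₁, h₂, h₃, h₄⟩
  exact ⟨ψ, h₁.trans (by exact_mod_cast hn), h₂.trans (hℓ hn), h₃, h₄⟩

/-- A network function with `K` weights belongs to the unit ball as soon as it is bounded by
`K ^ (-α)`: it is its own approximation with `n ≥ K` weights, and `0` is good enough for `n < K`. -/
theorem mem_approxUnitBall_of_mem_networkClass {d : ℕ} {α : ℝ} (hα : 0 < α) {ℓ : ℕ+ → ℕ∞}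
    (hmono : Monotone ℓ) (hpos : ∀ n, 1 ≤ ℓ n) {K : ℕ+} (f : C(Fin d → ℝ, ℝ))
    (hf : (f : (Fin d → ℝ) → ℝ) ∈ networkClass d ℓ K)
    (hbd : ∀ x, |f x| ≤ ((K : ℕ) : ℝ) ^ (-α)) :
    f ∈ approxUnitBall d α ℓ := by
  have hK : (1 : ℝ) ≤ (K : ℕ) := by exact_mod_cast K.pos
  have hnorm : eLpNorm f ∞ volume ≤ ENNReal.ofReal (((K : ℕ) : ℝ) ^ (-α)) := by
    rw [eLpNorm_exponent_top]
    exact eLpNormEssSup_le_of_ae_bound (.of_forall hbd)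
  have hΓ : approxGamma α ℓ (fun x => f x / 1) ≤ 1 := by
    simp only [div_one]
    refine max_le (hnorm.trans ?_) (iSup_le fun n => ?_)
    · rw [ENNReal.ofReal_le_one]
      exact Real.rpow_le_one_of_one_le_of_nonpos hK (by linarith)
    · rcases le_or_gt K n with h | h
      · have : distSup f (networkClass d ℓ n) = 0 := by
          refine le_antisymm ((iInf₂_le _ (networkClass_mono hmono h hf)).trans ?_) zero_le
          simp only [sub_self, eLpNorm_zero', le_refl]
        simp [this]
      · have : distSup f (networkClass d ℓ n) ≤ ENNReal.ofReal (((K : ℕ) : ℝ) ^ (-α)) := by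
          refine (iInf₂_le _ (zero_mem_networkClass (hpos n))).trans ?_
          simpa using hnorm
        have hn : ((n : ℕ) : ℝ≥0∞) ^ α ≤ ENNReal.ofReal (((K : ℕ) : ℝ) ^ α) := by
          rw [← ENNReal.ofReal_rpow_of_nonneg (by positivity) hα.le, ENNReal.ofReal_natCast]
          gcongr
          exact_mod_cast h.le
        calc _ ≤ ENNReal.ofReal (((K : ℕ) : ℝ) ^ α) * ENNReal.ofReal (((K : ℕ) : ℝ) ^ (-α)) := by
              gcongr
          _ = 1 := by
              rw [← ENNReal.ofReal_mul (by positivity), ← Real.rpow_add (by positivity)]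
              simp
  rw [approxUnitBall, Set.mem_ofPred]
  -- `θ = 1` is admissible in the infimum defining the quasi-norm.
  refine (iInf_le _ 1).trans ?_
  simp only [div_one] at hΓ
  simp [hΓ]

/-- A supremum of extended naturals is reached if it is finite, and every finite depth is exceeded
otherwise. -/
theorem le_maxDepth_iff {ℓ : ℕ+ → ℕ∞} {k : ℕ} : (k : ℕ∞) ≤ maxDepth ℓ ↔ ∃ n, (k : ℕ∞) ≤ ℓ n := by
  refine ⟨fun h => ?_, fun ⟨n, hn⟩ => hn.trans (le_iSup ℓ n)⟩
  rcases k with _ | k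
  · exact ⟨1, by simp⟩
  · have : (k : ℕ∞) < ⨆ n, ℓ n := lt_of_lt_of_le (by exact_mod_cast k.lt_succ_self) h
    obtain ⟨n, hn⟩ := lt_iSup_iff.1 this
    exact ⟨n, by simpa using Order.add_one_le_of_lt hn⟩

/-! ### Averaging over fooling functions -/

/-- Lower bound for randomized methods by averaging over a finite family of functions `± g i` with
disjoint supports: a deterministic method with `k` samples misses the supports of all but `k` of the
`g i`, and cannot distinguish `g i` from `- g i` if it misses the support of `g i`. -/
theorem half_le_optRandError {X : Type u} [TopologicalSpace X] {V : Type v} [NormedAddCommGroup V]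
    [NormedSpace ℝ V] {U : Set C(X, ℝ)} {ι : U → V} {N : ℕ} {I : Type*} [Fintype I] [Nonempty I]
    (hN : 2 * N ≤ Fintype.card I) (g g' : I → U)
    (hneg : ∀ i x, (g' i : C(X, ℝ)) x = -(g i : C(X, ℝ)) x)
    (hιneg : ∀ i, ι (g' i) = -ι (g i))
    (hdisj : ∀ i j x, (g i : C(X, ℝ)) x ≠ 0 → (g j : C(X, ℝ)) x ≠ 0 → i = j)
    {ε : ℝ≥0} (hε : ∀ i, ε ≤ ‖ι (g i)‖₊) :
    ((ε / 2 : ℝ≥0) : ℝ≥0∞) ≤ optRandError.{u, v, w} U ι N := by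
  classical
  refine le_iInf fun M => ?_
  let _ := M.mΩ
  have _ := M.isProb
  set err := M.error ι
  have hmeas (f : U) : Measurable fun ω => ‖ι f - M.A ω f‖ₑ := by
    let _ : MeasurableSpace V := borel V
    have _ : BorelSpace V := ⟨rfl⟩
    let _ := uniformBorel U
    have h₁ : Measurable fun ω => M.A ω f := M.measurable_joint.comp measurable_prodMk_right
    have h₂ : Continuous fun v : V => ‖ι f - v‖ₑ := by fun_prop
    exact h₂.measurable.comp h₁
  have hle (f : U) : ∫⁻ ω, ‖ι f - M.A ω f‖ₑ ∂M.P ≤ err :=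
    le_iSup (fun f : U => ∫⁻ ω, ‖ι f - M.A ω f‖ₑ ∂M.P) f
  -- For fixed `ω`: all but `M.cost ω` of the indices contribute at least `2 ε` to the error
  -- sum.
  have hpoint (ω : M.Ω) : (Fintype.card I : ℝ≥0∞) * (2 * ε) ≤
      ∑ i, (‖ι (g i) - M.A ω (g i)‖ₑ + ‖ι (g' i) - M.A ω (g' i)‖ₑ) + M.cost ω * (2 * ε) := by
    obtain ⟨x, Q, hQ⟩ := M.isDet ω
    let hit : Finset I := {i | ∃ t, (g i : C(X, ℝ)) (x t) ≠ 0}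
    have hcard : hit.card ≤ M.cost ω := by
      have hex (i : hit) : ∃ t, (g i : C(X, ℝ)) (x t) ≠ 0 := (Finset.mem_filter.1 i.2).2
      choose t ht using hex
      -- A sample point lies in at most one support.
      have hinj : Function.Injective t := fun i j hij =>
        Subtype.ext (hdisj _ _ (x (t i)) (ht i) (hij ▸ ht j))
      simpa using Fintype.card_le_of_injective t hinj
    calc (Fintype.card I : ℝ≥0∞) * (2 * ε) = ∑ _i : I, (2 * ε : ℝ≥0∞) := by simp
      _ ≤ ∑ i, (‖ι (g i) - M.A ω (g i)‖ₑ + ‖ι (g' i) - M.A ω (g' i)‖ₑ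
            + if i ∈ hit then 2 * (ε : ℝ≥0∞) else 0) := by
          refine Finset.sum_le_sum fun i _ => ?_
          split_ifs with hi
          · exact le_add_self
          -- On an unhit support the method sees only zeros, for `g i` as for `g' i`.
          · have h0 (t) : (g i : C(X, ℝ)) (x t) = 0 := by
              by_contra h
              exact hi (Finset.mem_filter.2 ⟨Finset.mem_univ _, t, h⟩)
            have hA : M.A ω (g' i) = M.A ω (g i) := by simp [hQ, hneg, h0]
            rw [add_zero, hA, hιneg]
            have h2 : (2 : ℝ≥0) * ε ≤ ‖ι (g i) - M.A ω (g i)‖₊ + ‖-ι (g i) - M.A ω (g i)‖₊ := by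
              calc (2 : ℝ≥0) * ε ≤ 2 * ‖ι (g i)‖₊ := by gcongr; exact hε i
                _ = ‖(2 : ℕ) • ι (g i)‖₊ := by
                  rw [← Nat.cast_smul_eq_nsmul ℝ, nnnorm_smul]
                  simp
                _ = ‖(ι (g i) - M.A ω (g i)) - (-ι (g i) - M.A ω (g i))‖₊ := by
                  congr 1; abel
                _ ≤ _ := nnnorm_sub_le _ _
            simp only [enorm_eq_nnnorm]
            exact_mod_cast h2
      _ = ∑ i, (‖ι (g i) - M.A ω (g i)‖ₑ + ‖ι (g' i) - M.A ω (g' i)‖ₑ)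
            + hit.card * (2 * ε) := by
          rw [Finset.sum_add_distrib]
          simp
      _ ≤ _ := by gcongr
  have hmeas' : Measurable fun ω =>
      ∑ i, (‖ι (g i) - M.A ω (g i)‖ₑ + ‖ι (g' i) - M.A ω (g' i)‖ₑ) :=
    Finset.measurable_fun_sum _ fun i _ => (hmeas _).add (hmeas _)
  have hint : (Fintype.card I : ℝ≥0∞) * (2 * ε) ≤
      Fintype.card I * (2 * err) + N * (2 * ε) := by
    calc (Fintype.card I : ℝ≥0∞) * (2 * ε)
        = ∫⁻ _ω, (Fintype.card I : ℝ≥0∞) * (2 * ε) ∂M.P := by simp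
      _ ≤ ∫⁻ ω, (∑ i, (‖ι (g i) - M.A ω (g i)‖ₑ + ‖ι (g' i) - M.A ω (g' i)‖ₑ)
            + M.cost ω * (2 * ε)) ∂M.P := lintegral_mono hpoint
      _ = ∑ i, (∫⁻ ω, ‖ι (g i) - M.A ω (g i)‖ₑ ∂M.P + ∫⁻ ω, ‖ι (g' i) - M.A ω (g' i)‖ₑ ∂M.P)
            + (∫⁻ ω, (M.cost ω : ℝ≥0∞) ∂M.P) * (2 * ε) := by
          rw [lintegral_add_left hmeas', lintegral_mul_const' _ _ (by finiteness),
            lintegral_finsetSum (f := fun i ω => ‖ι (g i) - M.A ω (g i)‖ₑ +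
              ‖ι (g' i) - M.A ω (g' i)‖ₑ) _ fun i _ => (hmeas _).add (hmeas _)]
          simp_rw [lintegral_add_left (hmeas _)]
      _ ≤ ∑ _i : I, (err + err) + N * (2 * ε) := by
          gcongr
          · exact hle _
          · exact hle _
          · exact M.lintegral_cost_le
      _ = _ := by simp [two_mul, mul_add]
  by_cases htop : err = ∞
  · simp [htop]
  lift err to ℝ≥0 using htop with e
  have hI : 0 < (Fintype.card I : ℝ) := by exact_mod_cast Fintype.card_pos
  have hN' : (2 * N : ℝ) ≤ Fintype.card I := by exact_mod_cast hN
  have hreal : (Fintype.card I : ℝ) * (2 * ε) ≤ Fintype.card I * (2 * e) + N * (2 * ε) := by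
    exact_mod_cast hint
  have : (ε / 2 : ℝ) ≤ e := by
    have h1 : (2 * N : ℝ) * ε ≤ Fintype.card I * ε := by gcongr
    have h2 : (Fintype.card I : ℝ) * (ε / 2) ≤ Fintype.card I * e := by linarith
    exact le_of_mul_le_mul_left h2 hI
  exact_mod_cast this

/-! ### The `L^p`-norm of a pyramid -/

/-- The `L^p`-norm of `pyramid y s h ∘ E` is bounded below by the contribution of a cube around `y`
on which the pyramid is at least half as high as its apex. -/
theorem le_eLpNorm_pyramid_comp {X : Type u} [MeasurableSpace X] {μ : Measure X} {p : ℝ≥0∞}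
    (hp₀ : p ≠ 0) (hp : p ≠ ∞) {d : ℕ} {E : X → Fin d → ℝ} (hE : Measurable E) {c : ℝ≥0}
    (hEμ : c • (volume.restrict (Set.Icc (0 : Fin d → ℝ) 1)) ≤ μ.map E)
    {y : Fin d → ℝ} {s h ρ : ℝ} (hs : 0 ≤ s) (hρ : 0 ≤ ρ) (hsh : s * (d * ρ) ≤ h / 2)
    (hball : Metric.closedBall y ρ ⊆ Set.Icc 0 1) :
    ENNReal.ofReal (h / 2 * (c * (2 * ρ) ^ d) ^ (1 / p.toReal)) ≤
      eLpNorm (pyramid y s h ∘ E) p μ := by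
  have hh : 0 ≤ h := by
    have : 0 ≤ s * (d * ρ) := by positivity
    linarith
  have hlow : ∀ x ∈ Metric.closedBall y ρ, h / 2 ≤ pyramid y s h x := by
    intro x hx
    have hx' : ∑ i, |x i - y i| ≤ d * ρ := by
      calc ∑ i, |x i - y i| ≤ ∑ _i : Fin d, ρ :=
            Finset.sum_le_sum fun i _ => (dist_le_pi_dist x y i).trans hx
        _ = d * ρ := by simp
    refine le_trans ?_ (le_max_right _ _)
    have := mul_le_mul_of_nonneg_left hx' hs
    linarith
  have hcont : Continuous (pyramid y s h) := continuous_pyramid y s h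
  rw [← eLpNorm_map_measure hcont.aestronglyMeasurable hE.aemeasurable]
  refine le_trans ?_ (eLpNorm_mono_measure _ hEμ)
  set ν := c • (volume.restrict (Set.Icc (0 : Fin d → ℝ) 1)) with hν
  have hνB : ν (Metric.closedBall y ρ) = ENNReal.ofReal (c * (2 * ρ) ^ d) := by
    rw [hν, Measure.smul_apply, Measure.restrict_apply Metric.isClosed_closedBall.measurableSet,
      Set.inter_eq_self_of_subset_left hball, Real.volume_pi_closedBall y hρ, Fintype.card_fin,
      ENNReal.ofReal_mul c.coe_nonneg, ENNReal.smul_def, smul_eq_mul, ENNReal.ofReal_coe_nnreal]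
  calc ENNReal.ofReal (h / 2 * (c * (2 * ρ) ^ d) ^ (1 / p.toReal))
      = eLpNorm ((Metric.closedBall y ρ).indicator fun _ => h / 2) p ν := by
        rw [eLpNorm_indicator_const Metric.isClosed_closedBall.measurableSet hp₀ hp, hνB,
          ENNReal.ofReal_mul (by positivity), ENNReal.ofReal_rpow_of_nonneg (by positivity)
            (by positivity), Real.enorm_eq_ofReal (by positivity)]
    _ ≤ eLpNorm (pyramid y s h) p ν := by
        refine eLpNorm_mono fun x => ?_
        by_cases hx : x ∈ Metric.closedBall y ρ
        · rw [Set.indicator_of_mem hx, Real.norm_of_nonneg (by positivity),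
            Real.norm_of_nonneg (pyramid_nonneg _ _ _ _)]
          exact hlow x hx
        · simp [Set.indicator_of_notMem hx]

/-! ### Pyramids over a grid -/

/-- The midpoints of the cells of the grid of `2 m` cells per direction in the unit cube. -/
noncomputable def gridPoint {d : ℕ} (m : ℕ) (i : Fin d → Fin (2 * m)) : Fin d → ℝ :=
  fun k => (2 * (i k : ℝ) + 1) / (4 * m)

theorem closedBall_gridPoint_subset {d m : ℕ} (hm : 1 ≤ m) (i : Fin d → Fin (2 * m)) {ρ : ℝ}
    (hρ : ρ ≤ 1 / (4 * m)) : Metric.closedBall (gridPoint m i) ρ ⊆ Set.Icc 0 1 := by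
  have hm' : (0 : ℝ) < m := by exact_mod_cast hm
  intro x hx
  have hxk (k : Fin d) : |x k - gridPoint m i k| ≤ 1 / (4 * m) :=
    ((dist_le_pi_dist x _ k).trans hx).trans hρ
  have hik (k : Fin d) : (i k : ℝ) + 1 ≤ 2 * m := by exact_mod_cast (i k).2
  have hlo (k : Fin d) : 1 / (4 * m) ≤ gridPoint m i k := by
    unfold gridPoint
    gcongr
    have : (0 : ℝ) ≤ (i k : ℝ) := by positivity
    linarith
  have hhi (k : Fin d) : gridPoint m i k ≤ 1 - 1 / (4 * m) := by
    have : (1 : ℝ) - 1 / (4 * m) = (4 * m - 1) / (4 * m) := by field_simp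
    rw [this, gridPoint]
    gcongr
    linarith [hik k]
  exact ⟨fun k => by have := (abs_le.1 (hxk k)).1; have := hlo k; simp; linarith,
    fun k => by have := (abs_le.1 (hxk k)).2; have := hhi k; simp; linarith⟩

/-- Pyramids over different cells have disjoint supports: the `ℓ¹`-balls of radius `h / s` around
the midpoints lie in the cells. -/
theorem eq_of_pyramid_gridPoint_ne_zero {d m : ℕ} (hm : 1 ≤ m) {i i' : Fin d → Fin (2 * m)}
    {s h : ℝ} (hs : 0 < s) (hsh : h ≤ s / (4 * m)) {x : Fin d → ℝ}
    (hx : pyramid (gridPoint m i) s h x ≠ 0) (hx' : pyramid (gridPoint m i') s h x ≠ 0) :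
    i = i' := by
  have hm' : (0 : ℝ) < m := by exact_mod_cast hm
  have key {j : Fin d → Fin (2 * m)} (hj : pyramid (gridPoint m j) s h x ≠ 0) (k : Fin d) :
      |x k - gridPoint m j k| < 1 / (4 * m) := by
    have h1 : 0 < h - s * ∑ k, |x k - gridPoint m j k| := by
      by_contra! hc
      exact hj (max_eq_left hc)
    have h2 : |x k - gridPoint m j k| ≤ ∑ k, |x k - gridPoint m j k| :=
      Finset.single_le_sum (f := fun k => |x k - gridPoint m j k|) (fun _ _ => abs_nonneg _)
        (Finset.mem_univ k)
    have h3 : s * ∑ k, |x k - gridPoint m j k| < s * (1 / (4 * m)) := by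
      rw [mul_one_div]
      linarith
    exact h2.trans_lt (lt_of_mul_lt_mul_left h3 hs.le)
  funext k
  have h1 := abs_lt.1 (key hx k)
  have h2 := abs_lt.1 (key hx' k)
  have e (j : Fin d → Fin (2 * m)) : gridPoint m j k * (4 * m) = 2 * (j k : ℝ) + 1 := by
    unfold gridPoint
    field_simp
  have e1 : 1 / (4 * (m : ℝ)) * (4 * m) = 1 := by field_simp
  have h4 : (0 : ℝ) < 4 * m := by positivity
  have a1 : (gridPoint m i k - gridPoint m i' k) * (4 * m) < 2 * (1 / (4 * m)) * (4 * m) := by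
    gcongr
    linarith
  have a2 : (gridPoint m i' k - gridPoint m i k) * (4 * m) < 2 * (1 / (4 * m)) * (4 * m) := by
    gcongr
    linarith
  rw [sub_mul, e, e, mul_assoc, e1] at a1 a2
  have b1 : ((i k : ℕ) : ℝ) < (i' k : ℕ) + 1 := by linarith
  have b2 : ((i' k : ℕ) : ℝ) < (i k : ℕ) + 1 := by linarith
  have c1 : (i k : ℕ) < (i' k : ℕ) + 1 := by exact_mod_cast b1
  have c2 : (i' k : ℕ) < (i k : ℕ) + 1 := by exact_mod_cast b2
  exact Fin.ext (by omega)

/-- The number of weights, per unit of `n`, that suffices for pyramids of slope `n ^ (j + 1)`. -/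
def pyramidWeights (d j : ℕ) : ℕ := 2 * d * (d + 2) + 4 * j + 3

theorem pyramid_mem_networkClass {d j n : ℕ} {ℓ : ℕ+ → ℕ∞} {K : ℕ+}
    (hK : pyramidWeights d j * n ≤ K) (hn : 1 ≤ n)
    (hdepth : ((max 3 (2 * (j + 1)) : ℕ) : ℕ∞) ≤ ℓ K) {y : Fin d → ℝ} (hy : ∀ i, |y i| ≤ 1)
    {h : ℝ} (hh₀ : 0 ≤ h) (hh : h ≤ 1) : pyramid y ((n : ℝ) ^ (j + 1)) h ∈ networkClass d ℓ K := by
  have hn' : (1 : ℝ) ≤ (n : ℝ) ^ j := one_le_pow₀ (by exact_mod_cast hn)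
  have hb : |h / (n : ℝ) ^ j| ≤ 1 := by
    rw [abs_of_nonneg (by positivity)]
    exact div_le_one_of_le₀ (hh.trans hn') (by positivity)
  -- The amplification multiplies the bias by `n ^ j`.
  refine ⟨.pyramidNet n j y (h / (n : ℝ) ^ j),
    (ReLUNet.numWeights_pyramidNet_le n j hn y _).trans hK,
    by rwa [ReLUNet.depth_pyramidNet], ReLUNet.maxWeight_pyramidNet_le n j hy hb, fun x => ?_⟩
  rw [ReLUNet.realize_pyramidNet, mul_div_cancel₀ _ (by positivity)]

/-- Lower bound for `m ^ d` samples, from the `(2 m) ^ d` pyramids of slope `n ^ (j + 1)` over the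
cells of a grid. The height `n ^ (j + 1) / (4 m)` makes the supports disjoint; it must be small
enough for the pyramids to lie in the unit ball. -/
theorem le_optRandError_of_grid {X : Type u} [TopologicalSpace X] [MeasurableSpace X]
    {μ : Measure X} {p : ℝ≥0∞} [Fact (1 ≤ p)] (hp : p ≠ ∞)
    (U : Set C(X, ℝ)) (hU : ∀ G ∈ U, MemLp G p μ) {d : ℕ} (hd : 1 ≤ d)
    {E : X → Fin d → ℝ} (hE : Measurable E) {c : ℝ≥0}
    (hEμ : c • (volume.restrict (Set.Icc (0 : Fin d → ℝ) 1)) ≤ μ.map E)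
    {α : ℝ} (hα : 0 < α) {ℓ : ℕ+ → ℕ∞} (hmono : Monotone ℓ) (hpos : ∀ n, 1 ≤ ℓ n)
    (hincl : ∀ f ∈ approxUnitBall d α ℓ, ∃ G ∈ U, (G : X → ℝ) = f ∘ E)
    {j n m : ℕ} {K : ℕ+} (hK : pyramidWeights d j * n = K) (hn : 1 ≤ n) (hm : 1 ≤ m)
    (hdepth : ((max 3 (2 * (j + 1)) : ℕ) : ℕ∞) ≤ ℓ K)
    (hheight : (n : ℝ) ^ (j + 1) / (4 * m) ≤ ((K : ℕ) : ℝ) ^ (-α)) :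
    ENNReal.ofReal ((n : ℝ) ^ (j + 1) / (4 * m) / 2 *
        (c * (2 * (1 / (8 * m * d))) ^ d) ^ (1 / p.toReal) / 2) ≤
      optRandError.{u, u, w} U (lpEmbedding U hU) (m ^ d) := by
  have hm' : (0 : ℝ) < m := by exact_mod_cast hm
  have hd' : (1 : ℝ) ≤ d := by exact_mod_cast hd
  have hn' : (0 : ℝ) < n := by exact_mod_cast hn
  set s : ℝ := (n : ℝ) ^ (j + 1) with hs
  set h : ℝ := s / (4 * m) with hh
  have hs₀ : 0 < s := by positivity
  have hh₀ : 0 ≤ h := by positivity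
  have hh₁ : h ≤ 1 := hheight.trans
    (Real.rpow_le_one_of_one_le_of_nonpos (by exact_mod_cast K.pos) (by linarith))
  set f : (Fin d → Fin (2 * m)) → C(Fin d → ℝ, ℝ) := fun i =>
    ⟨pyramid (gridPoint m i) s h, continuous_pyramid _ _ _⟩ with hf
  have hclass (i : Fin d → Fin (2 * m)) : pyramid (gridPoint m i) s h ∈ networkClass d ℓ K := by
    refine pyramid_mem_networkClass hK.le hn hdepth (fun k => ?_) hh₀ hh₁
    have := closedBall_gridPoint_subset hm i (ρ := 0) (by positivity)
      (Metric.mem_closedBall_self le_rfl)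
    rw [abs_of_nonneg (this.1 k)]
    exact this.2 k
  have habs (i : Fin d → Fin (2 * m)) (x) :
      |pyramid (gridPoint m i) s h x| ≤ ((K : ℕ) : ℝ) ^ (-α) := by
    rw [abs_of_nonneg (pyramid_nonneg _ _ _ _)]
    exact (pyramid_le _ hs₀.le hh₀ x).trans hheight
  have hball (i) : f i ∈ approxUnitBall d α ℓ :=
    mem_approxUnitBall_of_mem_networkClass hα hmono hpos _ (hclass i) (habs i)
  have hball' (i) : -f i ∈ approxUnitBall d α ℓ :=
    mem_approxUnitBall_of_mem_networkClass hα hmono hpos _ (neg_mem_networkClass (hclass i))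
      (fun x => by simpa [hf] using habs i x)
  choose g hgU hg using fun i => hincl _ (hball i)
  choose g' hgU' hg' using fun i => hincl _ (hball' i)
  have hneg (i) : g' i = -g i := by
    ext x
    simp [hg, hg']
  set ε : ℝ≥0 := (h / 2 * (c * (2 * (1 / (8 * m * d))) ^ d) ^ (1 / p.toReal)).toNNReal with hε
  have : NeZero (2 * m) := ⟨by omega⟩
  have main := half_le_optRandError.{u, u, w} (ι := lpEmbedding U hU) (N := m ^ d)
    (I := Fin d → Fin (2 * m)) (ε := ε) ?_ (fun i => ⟨g i, hgU i⟩) (fun i => ⟨g' i, hgU' i⟩)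
    ?_ ?_ ?_ ?_
  · refine le_trans (le_of_eq ?_) main
    rw [ENNReal.ofReal, ENNReal.coe_inj, hε, Real.toNNReal_div' (by norm_num)]
    simp
  · simp only [Fintype.card_pi, Fintype.card_fin, Finset.prod_const, Finset.card_univ, mul_pow]
    gcongr
    exact Nat.le_self_pow (by omega) 2
  · intro i x
    simp [hneg]
  · intro i
    simp only [lpEmbedding, hneg]
    exact MemLp.toLp_neg _
  · intro i i' x hx hx'
    simp only [hg, Function.comp_apply] at hx hx'
    exact eq_of_pyramid_gridPoint_ne_zero hm hs₀ le_rfl hx hx'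
  · intro i
    rw [← ENNReal.coe_le_coe, ← enorm_eq_nnnorm]
    simp only [lpEmbedding]
    rw [Lp.enorm_toLp, hg]
    -- The pyramid has at least half its height on the `ℓ¹`-ball of radius `1 / (8 m)`,
    -- which contains the sup-norm ball of radius `1 / (8 m d)`.
    refine le_eLpNorm_pyramid_comp (ρ := 1 / (8 * m * d)) (zero_lt_one.trans_le Fact.out).ne' hp
      hE hEμ hs₀.le (by positivity) ?_ (closedBall_gridPoint_subset hm i ?_)
    · rw [hh]
      refine le_of_eq ?_
      field_simp
      norm_num
    · refine one_div_le_one_div_of_le (by positivity) ?_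
      nlinarith

/-! ### The rate of convergence -/

theorem le_of_eventually_rpow_le {a b C : ℝ}
    (h : ∀ᶠ n : ℕ in Filter.atTop, (n : ℝ) ^ a ≤ C * (n : ℝ) ^ b) : a ≤ b := by
  by_contra! hab
  have ht : Filter.Tendsto (fun n : ℕ => (n : ℝ) ^ (a - b)) Filter.atTop Filter.atTop :=
    (tendsto_rpow_atTop (sub_pos.2 hab)).comp tendsto_natCast_atTop_atTop
  obtain ⟨n, h1, h2, h3⟩ :=
    (h.and ((ht.eventually_gt_atTop C).and (Filter.eventually_ge_atTop 1))).exists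
  have hn : (0 : ℝ) < n := by exact_mod_cast h3
  rw [Real.rpow_sub hn, lt_div_iff₀ (by positivity)] at h2
  linarith

/-- The exponents in the error bounds of a rate `β`, for `m ≈ n ^ (α + k)` and `m ^ d` samples. -/
theorem rate_le_of_eventually {α k q β B C : ℝ} {d : ℕ} (hd : 1 ≤ d) (hα : 0 < α) (hk : 0 < k)
    (hB : 1 ≤ B)
    (h : ∀ᶠ n : ℕ in Filter.atTop, ∃ m : ℕ, B * (n : ℝ) ^ (α + k) ≤ m ∧
      (m : ℝ) ≤ 2 * (B * (n : ℝ) ^ (α + k)) ∧ (n : ℝ) ^ k ≤ C * (m : ℝ) ^ (1 + d / q - d * β)) :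
    β ≤ 1 / q + 1 / d * (α / (α + k)) := by
  have hd' : (0 : ℝ) < d := by exact_mod_cast hd
  have hαk : 0 < α + k := by positivity
  set γ := 1 + d / q - d * β with hγ
  -- The upper bound for `m` applies to nonnegative exponents only; since `k > 0`, the inequality
  -- obtained for `max γ 0` forces `γ > 0`.
  have h1 : k ≤ (α + k) * max γ 0 := by
    refine le_of_eventually_rpow_le (C := |C| * (2 * B) ^ max γ 0) ?_
    filter_upwards [h, Filter.eventually_ge_atTop 1] with n ⟨m, hm₁, hm₂, hm₃⟩ hn
    have hn' : (1 : ℝ) ≤ n := by exact_mod_cast hn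
    have hm : 1 ≤ (m : ℝ) :=
      (one_le_mul_of_one_le_of_one_le hB (Real.one_le_rpow hn' hαk.le)).trans hm₁
    calc (n : ℝ) ^ k ≤ C * (m : ℝ) ^ γ := hm₃
      _ ≤ |C| * (m : ℝ) ^ γ := by gcongr; exact le_abs_self C
      _ ≤ |C| * (m : ℝ) ^ max γ 0 := by gcongr; exact le_max_left _ _
      _ ≤ |C| * (2 * (B * (n : ℝ) ^ (α + k))) ^ max γ 0 := by gcongr
      _ = |C| * (2 * B) ^ max γ 0 * (n : ℝ) ^ ((α + k) * max γ 0) := by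
          rw [← mul_assoc 2, Real.mul_rpow (by positivity) (by positivity),
            ← Real.rpow_mul (by positivity)]
          ring
  have h2 : k ≤ (α + k) * γ := by
    rcases le_total γ 0 with hγ0 | hγ0
    · rw [max_eq_right hγ0] at h1
      linarith
    · rwa [max_eq_left hγ0] at h1
  have h3 : k / (α + k) ≤ γ := by rwa [div_le_iff₀' hαk]
  have h4 : α / (α + k) = 1 - k / (α + k) := by field_simp; ring
  have h5 : d * β ≤ d * (1 / q + 1 / d * (α / (α + k))) := by
    have : (d : ℝ) * (1 / q + 1 / d * (α / (α + k))) = d / q + α / (α + k) := by field_simp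
    rw [this, h4]
    linarith
  exact le_of_mul_le_mul_left h5 hd'

/-- The bound on the rate that networks of depth `max 3 (2 * (j + 1))` give. If `ℓ^*` is finite,
only `j + 1 = ⌊ℓ^* / 2⌋` matters; if `ℓ^* = ∞`, the claim is the limit `j → ∞`. -/
theorem betaStar_le_of_le_maxDepth {X : Type u} [TopologicalSpace X] [MeasurableSpace X]
    {μ : Measure X} {p : ℝ≥0∞} [Fact (1 ≤ p)] (hp : p ≠ ∞)
    (U : Set C(X, ℝ)) (hU : ∀ G ∈ U, MemLp G p μ) {d : ℕ} (hd : 1 ≤ d)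
    {E : X → Fin d → ℝ} (hE : Measurable E) {c : ℝ≥0} (hc : 0 < c)
    (hEμ : c • (volume.restrict (Set.Icc (0 : Fin d → ℝ) 1)) ≤ μ.map E)
    {α : ℝ} (hα : 0 < α) {ℓ : ℕ+ → ℕ∞} (hmono : Monotone ℓ) (hpos : ∀ n, 1 ≤ ℓ n)
    (hincl : ∀ f ∈ approxUnitBall d α ℓ, ∃ G ∈ U, (G : X → ℝ) = f ∘ E)
    {j : ℕ} (hj : ((max 3 (2 * (j + 1)) : ℕ) : ℕ∞) ≤ maxDepth ℓ) :
    betaStar.{u, u, w} U (lpEmbedding U hU) ≤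
      1 / p + 1 / (d : ℝ≥0∞) * (ENNReal.ofReal α / (ENNReal.ofReal α + (j + 1 : ℕ))) := by
  have hp1 : 1 ≤ p := Fact.out
  have hp₀ : 0 < p.toReal := ENNReal.toReal_pos (zero_lt_one.trans_le hp1).ne' hp
  have hd' : (0 : ℝ) < d := by exact_mod_cast hd
  obtain ⟨n₀, hn₀⟩ := le_maxDepth_iff.1 hj
  refine iSup₂_le fun β ⟨C, hC, hβ⟩ => ?_
  set q := p.toReal with hq
  have hKpos : 0 < pyramidWeights d j := by unfold pyramidWeights; omega
  have hreal : (β : ℝ) ≤ 1 / q + 1 / d * (α / (α + (j + 1 : ℕ))) := by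
    -- With `K = pyramidWeights d j * n` weights the height has to be at most `K ^ (-α)`, that is,
    -- `4 m ≥ pyramidWeights d j ^ α * n ^ (α + j + 1)`; `m` is chosen of this order.
    refine rate_le_of_eventually (B := (pyramidWeights d j : ℝ) ^ α)
      (C := C * 16 / ((c : ℝ) * (4 * d) ^ (-d : ℝ)) ^ (1 / q)) hd hα (by positivity)
      (Real.one_le_rpow (by exact_mod_cast hKpos) hα.le) ?_
    filter_upwards [Filter.eventually_ge_atTop (n₀ : ℕ)] with n hn
    have hn1 : 1 ≤ n := n₀.pos.trans_le hn
    have hn' : (1 : ℝ) ≤ n := by exact_mod_cast hn1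
    set B := (pyramidWeights d j : ℝ) ^ α with hB
    have hB1 : 1 ≤ B := Real.one_le_rpow (by exact_mod_cast hKpos) hα.le
    set t := B * (n : ℝ) ^ (α + (j + 1 : ℕ)) with ht
    have ht1 : 1 ≤ t := one_le_mul_of_one_le_of_one_le hB1 (Real.one_le_rpow hn' (by positivity))
    refine ⟨⌈t⌉₊, Nat.le_ceil t, ?_, ?_⟩
    · have := Nat.ceil_lt_add_one (zero_le_one.trans ht1)
      linarith
    set m := ⌈t⌉₊ with hm
    have hm1 : 1 ≤ m := Nat.one_le_ceil_iff.2 (by linarith)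
    have htm : t ≤ m := Nat.le_ceil t
    have hm' : (0 : ℝ) < m := by exact_mod_cast hm1
    let K : ℕ+ := ⟨pyramidWeights d j * n, by positivity⟩
    have hK : (n₀ : ℕ) ≤ K := hn.trans (Nat.le_mul_of_pos_left n hKpos)
    have hheight : (n : ℝ) ^ (j + 1) / (4 * m) ≤ ((K : ℕ) : ℝ) ^ (-α) := by
      have e1 : t = ((K : ℕ) : ℝ) ^ α * (n : ℝ) ^ (j + 1) := by
        simp only [K, PNat.mk_coe, Nat.cast_mul]
        rw [Real.mul_rpow (by positivity) (by positivity), ht, Real.rpow_add (by positivity),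
          Real.rpow_natCast]
        ring
      have hKr : (0 : ℝ) < (K : ℕ) := by exact_mod_cast K.pos
      rw [Real.rpow_neg hKr.le, ← one_div, div_le_div_iff₀ (by positivity) (by positivity),
        mul_comm, ← e1]
      linarith
    have h1 := (le_optRandError_of_grid.{u, w} hp U hU hd hE hEμ hα hmono hpos hincl (K := K) rfl
      hn1 hm1 (hn₀.trans (hmono hK)) hheight).trans (hβ _ (Nat.one_le_pow _ _ hm1))
    rw [ENNReal.ofReal_le_ofReal_iff (by positivity)] at h1
    have e2 : (c : ℝ) * (2 * (1 / (8 * m * d))) ^ d =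
        (c * (4 * d) ^ (-d : ℝ)) * (m : ℝ) ^ (-d : ℝ) := by
      rw [Real.rpow_neg (by positivity), Real.rpow_neg (by positivity), Real.rpow_natCast,
        Real.rpow_natCast, mul_assoc (c : ℝ), ← mul_inv, ← mul_pow, ← inv_pow]
      congr 2
      field_simp
      norm_num
    rw [← hq, e2, Real.mul_rpow (by positivity) (by positivity)] at h1
    set D := ((c : ℝ) * (4 * d) ^ (-d : ℝ)) ^ (1 / q) with hD
    have hD0 : 0 < D := by positivity
    have e3 : (m : ℝ) ^ (1 + d / q - d * β) * (((m : ℝ) ^ (-d : ℝ)) ^ (1 / q)) =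
        m * ((m ^ d : ℕ) : ℝ) ^ (-(β : ℝ)) := by
      have hone (y : ℝ) : (m : ℝ) * (m : ℝ) ^ y = (m : ℝ) ^ (1 + y) := by
        rw [Real.rpow_add hm', Real.rpow_one]
      rw [Nat.cast_pow, ← Real.rpow_natCast, ← Real.rpow_mul hm'.le, ← Real.rpow_mul hm'.le,
        ← Real.rpow_add hm', hone]
      congr 1
      ring
    have h2 : (((m : ℝ) ^ (-d : ℝ)) ^ (1 / q)) > 0 := by positivity
    rw [Real.rpow_natCast, ← mul_le_mul_iff_left₀ h2, mul_assoc, e3, div_mul_eq_mul_div,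
      le_div_iff₀ hD0]
    calc _ = (n : ℝ) ^ (j + 1) / (4 * m) / 2 * (D * ((m : ℝ) ^ (-d : ℝ)) ^ (1 / q)) / 2
            * (16 * m) := by field_simp; norm_num
      _ ≤ C * ((m ^ d : ℕ) : ℝ) ^ (-(β : ℝ)) * (16 * m) := by gcongr
      _ = _ := by ring
  have hfin : (1 / p + 1 / (d : ℝ≥0∞) * (ENNReal.ofReal α / (ENNReal.ofReal α + (j + 1 : ℕ)))) =
      ENNReal.ofReal (1 / q + 1 / d * (α / (α + (j + 1 : ℕ)))) := by
    rw [ENNReal.ofReal_add (by positivity) (by positivity), ENNReal.ofReal_mul (by positivity),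
      ENNReal.ofReal_div_of_pos (by positivity), ENNReal.ofReal_div_of_pos hd',
      ENNReal.ofReal_div_of_pos (by positivity), ENNReal.ofReal_add hα.le (by positivity),
      ENNReal.ofReal_natCast, ENNReal.ofReal_natCast, hq, ENNReal.ofReal_toReal hp,
      ENNReal.ofReal_one]
  rw [hfin, ← ENNReal.ofReal_coe_nnreal]
  exact ENNReal.ofReal_le_ofReal hreal

theorem mainTheorem2 {X : Type u} [NormedAddCommGroup X] [NormedSpace ℝ X] [CompleteSpace X]
    [TopologicalSpace.SeparableSpace X] [MeasurableSpace X] [BorelSpace X]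
    (μ : Measure X) [IsProbabilityMeasure μ]
    (p : ℝ≥0∞) [Fact (1 ≤ p)] (hp : p ≠ ∞)
    (U : Set C(X, ℝ)) (hU : ∀ G ∈ U, MemLp G p μ)
    (d : ℕ) (hd : 1 ≤ d)
    (E : X → Fin d → ℝ) (hE : Measurable E)
    (c : ℝ≥0) (hc : 0 < c)
    (hEμ : c • (volume.restrict (Set.Icc (0 : Fin d → ℝ) 1)) ≤ μ.map E)
    (α : ℝ) (hα : 0 < α)
    (ℓ : ℕ+ → ℕ∞) (hℓ_mono : Monotone ℓ) (hℓ_pos : ∀ n, 1 ≤ ℓ n) (hℓ : 3 ≤ maxDepth ℓ)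
    (hincl : ∀ f ∈ approxUnitBall d α ℓ, ∃ G ∈ U, (G : X → ℝ) = f ∘ E) :
    betaStar.{u, u, w} U (lpEmbedding U hU) ≤
      1 / p + 1 / (d : ℝ≥0∞) *
        (ENNReal.ofReal α / (ENNReal.ofReal α + (halfMaxDepth ℓ : ℝ≥0∞))) := by
  have key (j : ℕ) (hj : ((max 3 (2 * (j + 1)) : ℕ) : ℕ∞) ≤ maxDepth ℓ) :=
    betaStar_le_of_le_maxDepth.{u, w} hp U hU hd hE hc hEμ hα hℓ_mono hℓ_pos hincl hj
  induction hL : maxDepth ℓ using ENat.recTopCoe with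
  | top =>
    have htop : halfMaxDepth ℓ = ⊤ := by rw [halfMaxDepth, hL]; rfl
    have hlim : Filter.Tendsto (fun j : ℕ => 1 / p + 1 / (d : ℝ≥0∞) *
        (ENNReal.ofReal α / (ENNReal.ofReal α + (j + 1 : ℕ)))) Filter.atTop
        (nhds (1 / p + 1 / (d : ℝ≥0∞) * (ENNReal.ofReal α / (ENNReal.ofReal α + ∞)))) := by
      refine tendsto_const_nhds.add (ENNReal.Tendsto.const_mul (ENNReal.Tendsto.const_div
        (tendsto_const_nhds.add ?_) (.inr ENNReal.ofReal_ne_top)) (.inr ?_))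
      · exact ENNReal.tendsto_nat_nhds_top.comp (Filter.tendsto_add_atTop_nat 1)
      · simp; omega
    rw [htop, ENat.toENNReal_top]
    exact ge_of_tendsto' hlim fun j => key j (by rw [hL]; exact le_top)
  | coe L =>
    have hL3 : 3 ≤ L := by rw [hL] at hℓ; exact_mod_cast hℓ
    have hhalf : halfMaxDepth ℓ = ((L / 2 - 1 + 1 : ℕ) : ℕ∞) := by
      rw [halfMaxDepth, hL, Nat.sub_add_cancel (by omega)]; rfl
    rw [hhalf, ENat.toENNReal_coe]
    refine key _ ?_
    rw [hL]
    exact ENat.natCast_le_natCast.2 (by omega)
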